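/- Let $k\ge 2$ and let $H=K_{k+1}^{(k)}$ be the $k$-uniform simplex: its vertex set is $[k+1]$ and its edges are all $k$-element subsets of $[k+1]$. For an edge $e$ and $u\in e$, let $S_e(u)$ be the directed star with vertex set $e$ and arcs $u\to v$ for all $v\in e\setminus\{u\}$. A \emph{rooting} of $H$ is a sequence $R=(S_{e_1}(v_1),\dots,S_{e_m}(v_m))$ in which every edge of $H$ occurs exactly once among $e_1,\dots,e_m$, with $v_i\in e_i$ and $v_1\le v_2\le\dots\le v_m$. Its digraph $D_R$ is the union of these stars, edge multiplicities being added, and $R$ is an \emph{Euler rooting} if $D_R$ is Eulerian, i.e. has an Euler circuit (a closed walk that traverses every arc exactly once and visits every vertex). For a digraph $D$ and a specified root vertex $r$, let $\tau_D$ be the number of spanning arborescences of $D$ rooted at $r$, and put \[ C_H=\sum_{R}\frac{\tau_{D_R}}{\prod_{v\in V(D_R)}\deg^-_{D_R}(v)}, \] the sum being over all Euler rootings $R$ of $H$. Let $\mathfrak D_{k+1}$ be the set of derangements (permutations without fixed points) of $[k+1]$. Then: (1) The map \[ \sigma\longmapsto\bigl(S_{[k+1]\setminus\{\sigma(1)\}}(1),\dots,S_{[k+1]\setminus\{\sigma(k+1)\}}(k+1)\bigr)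 \] is a bijection from $\mathfrak D_{k+1}$ onto the set of Euler rootings of $H$. (2) For every choice of the root $r\in[k+1]$, \[ C_H=\frac{1}{(k-1)^{k+1}(k+1)^2}\sum_{\sigma=c_1c_2\cdots c_t\in\mathfrak D_{k+1}}\ \prod_{i=1}^{t}\left(k^{\ell_i}+(-1)^{\ell_i+1}\right), \] where $c_1c_2\cdots c_t$ is the cycle decomposition of $\sigma$ and $\ell_i$ is the length of $c_i$. -/

import Mathlib

/-- A multi-hypergraph with vertex set `V`: its edges form a multiset of sets of vertices. -/
structure MultiHypergraph (V : Type*) where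
  edges : Multiset (Finset V)

/-- A directed multigraph with finitely many vertices taken from `V`. The pair `(x, y)` stands for
an arc from `x` to `y`, and its multiplicity in `arcs` is the number of parallel arcs. -/
structure MultiDigraph (V : Type*) where
  verts : Finset V
  arcs : Multiset (V × V)
  incidence : ∀ a ∈ arcs, a.1 ∈ verts ∧ a.2 ∈ verts

namespace MultiDigraph

variable {V : Type*} [DecidableEq V]

/-- The digraph without vertices. -/
def empty : MultiDigraph V where
  verts := ∅
  arcs := 0
  incidence := by simp

/-- Union of digraphs; edge multiplicities are added. -/
def union (D E : MultiDigraph V) : MultiDigraph V where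
  verts := D.verts ∪ E.verts
  arcs := D.arcs + E.arcs
  incidence := by
    intro a ha
    rcases Multiset.mem_add.mp ha with h | h
    · have := D.incidence a h
      simp [this.1, this.2]
    · have := E.incidence a h
      simp [this.1, this.2]

/-- The in-degree of `v`, with multiplicities. -/
def inDegree (D : MultiDigraph V) (v : V) : ℕ :=
  D.arcs.countP (fun a => a.2 = v)

/-- `D` is Eulerian: it has an Euler circuit, that is, a cyclic sequence `w` of vertices that visits
every vertex and whose consecutive pairs (the last one closing up) run through every arc of `D`
exactly once. -/
def IsEulerian (D : MultiDigraph V) : Prop :=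
  ∃ w : List V, (↑(w.zip (w.rotate 1)) : Multiset (V × V)) = D.arcs ∧ ∀ v ∈ D.verts, v ∈ w

/-- `T` is (the arc set of) a spanning arborescence of `D` with root `r`. The arcs of `D` are
distinguished by a counter: the parallel arcs from `x` to `y` are `((x, y), 0)`, `((x, y), 1)`, etc. -/
structure IsArborescence (D : MultiDigraph V) (r : V) (T : Finset ((V × V) × ℕ)) : Prop where
  subset : T ⊆ D.arcs.toEnumFinset
  root_mem : r ∈ D.verts
  root_no_arc : ∀ a ∈ T, a.1.2 ≠ r
  unique_arc : ∀ v ∈ D.verts, v ≠ r → ∃! a, a ∈ T ∧ a.1.2 = v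
  reachable : ∀ v ∈ D.verts, Relation.ReflTransGen (fun x y => ∃ a ∈ T, a.1 = (x, y)) r v

open Classical in
/-- The number of spanning arborescences of `D` with the specified root `r`. -/
noncomputable def tau (D : MultiDigraph V) (r : V) : ℕ :=
  (D.arcs.toEnumFinset.powerset.filter (D.IsArborescence r)).card

end MultiDigraph

/-- An edge together with one of its vertices, its root; it stands for the directed star
`S_e(u)`. -/
@[ext]
structure RootedEdge (V : Type*) where
  edge : Finset V
  root : V
  root_mem : root ∈ edge

/-- The star of a rooted edge: vertex set `e`, and an arc `(u, v)` for each `v ∈ e`, `v ≠ u`. -/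
def RootedEdge.star {V : Type*} [DecidableEq V] (s : RootedEdge V) : MultiDigraph V where
  verts := s.edge
  arcs := (s.edge.erase s.root).val.map (fun v => (s.root, v))
  incidence := by
    intro a ha
    obtain ⟨v, hv, rfl⟩ := Multiset.mem_map.mp ha
    exact ⟨s.root_mem, Finset.mem_of_mem_erase hv⟩

/-- The rooted multi-digraph `D_R` of a sequence `R` of rooted stars. -/
def rootedDigraph {V : Type*} [DecidableEq V] (R : List (RootedEdge V)) : MultiDigraph V :=
  (R.map RootedEdge.star).foldr MultiDigraph.union MultiDigraph.empty

namespace MultiHypergraph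

variable {V : Type*} [LinearOrder V]

/-- `R` is a rooting of `H`: its edges are those of `H`, with multiplicities, and its sequence of
roots is weakly increasing. -/
def IsRooting (H : MultiHypergraph V) (R : List (RootedEdge V)) : Prop :=
  (↑(R.map RootedEdge.edge) : Multiset (Finset V)) = H.edges ∧
    (R.map RootedEdge.root).Pairwise (· ≤ ·)

/-- The set of Euler rootings of `H`. -/
def eulerRootings (H : MultiHypergraph V) : Set (List (RootedEdge V)) :=
  {R | H.IsRooting R ∧ (rootedDigraph R).IsEulerian}

theorem eulerRootings_finite [Finite V] (H : MultiHypergraph V) : H.eulerRootings.Finite := by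
  have : Finite (RootedEdge V) :=
    Finite.of_injective (fun s : RootedEdge V => (s.edge, s.root)) (by
      intro s t h
      simp only [Prod.mk.injEq] at h
      exact RootedEdge.ext h.1 h.2)
  refine (List.finite_length_eq (RootedEdge V) (Multiset.card H.edges)).subset ?_
  rintro R ⟨⟨h, -⟩, -⟩
  simp [← h]

/-- The associated coefficient `C_H` of a connected Veblen hypergraph `H`: the sum of
`τ_D / ∏_{v ∈ V(D)} deg⁻(v)` over the Euler rootings of `H`, where `D` is the digraph of the rooting
and `τ_D` counts its arborescences with the specified root `r`. The sum is finite by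
`eulerRootings_finite`. -/
noncomputable def assocCoeff (H : MultiHypergraph V) (r : V) : ℚ :=
  ∑ᶠ R ∈ H.eulerRootings,
    ((rootedDigraph R).tau r : ℚ) / ∏ v ∈ (rootedDigraph R).verts, ((rootedDigraph R).inDegree v : ℚ)

end MultiHypergraph

/-- The `k`-uniform simplex: `k + 1` vertices, and all `k`-subsets are edges. -/
def simplex (k : ℕ) : MultiHypergraph (Fin (k + 1)) where
  edges := (Finset.powersetCard k Finset.univ).val

/-- The sequence of stars attached to a derangement `σ`: its `i`-th term is the star of the edge that
omits the vertex `σ i`, rooted at `i`. -/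
def derangementRooting (k : ℕ) (σ : derangements (Fin (k + 1))) :
    List (RootedEdge (Fin (k + 1))) :=
  List.ofFn fun i =>
    { edge := Finset.univ.erase (σ.1 i)
      root := i
      root_mem := Finset.mem_erase.mpr ⟨(σ.2 i).symm, Finset.mem_univ i⟩ }

/-! ### Determinants -/

/-! In an Eulerian digraph every vertex is the tail of an arc, hence the root of some star. The
simplex has as many edges as vertices, so each vertex is a root exactly once; the star at `i` omits
one vertex `σ i`, and `σ` is injective because each edge is used once and fixed-point free because a
root lies in its edge. Conversely, the digraph of a derangement has all in- and out-degrees `k - 1`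
and any two vertices are linked by a short path, so it is Eulerian.

For the coefficient, that digraph has no parallel arcs and its adjacency matrix is `J - I - P`, with
`J` all ones and `P` the matrix of `σ`. Its in-degree Laplacian `L` therefore satisfies `L + J = k I
+ Pᵀ`. As `L` has zero row and column sums, `det (L + J)` is `(k + 1) ^ 2` times any principal
cofactor, which is `tau` by the matrix-tree theorem (`det_inLaplacian_updateRow`). On the other side
`det (k I + P)` factors over the cycles of `σ`, a cycle of length `l` giving `k ^ l + (-1) ^ (l +
1)` (`det_supportMatrix`). -/

section ParentFunctions

variable {V : Type*} [Fintype V] [DecidableEq V]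

/-- The matrix whose row at `v ≠ r` is `e_v - e_{p v}` and whose row at `r` is `e_r`. -/
def parentMatrix (r : V) (p : V → V) : Matrix V V ℚ :=
  fun v => if v = r then Pi.single r 1 else Pi.single v 1 - Pi.single (p v) 1

/-- Ordering vertices by their distance `d` to the root makes the matrix block triangular, with
identity diagonal blocks, since a parent is strictly closer to `r`. -/
theorem det_parentMatrix_of_reach (r : V) (p : V → V) (h : ∀ v, ∃ m, p^[m] v = r) :
    (parentMatrix r p).det = 1 := by
  classical
  let d : V → ℕ := fun v => Nat.find (h v)
  have hd : ∀ v, v ≠ r → d (p v) < d v := by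
    intro v hv
    have h1 : p^[d v] v = r := Nat.find_spec (h v)
    obtain ⟨m, hm⟩ : ∃ m, d v = m + 1 := by
      apply Nat.exists_eq_succ_of_ne_zero
      intro h0
      rw [h0] at h1
      exact hv h1
    have h2 : d (p v) ≤ m := Nat.find_min' (h (p v)) (by rw [hm] at h1; exact h1)
    omega
  have hb : (parentMatrix r p).BlockTriangular (fun v => OrderDual.toDual (d v)) := by
    intro i j hij
    have hij : d i < d j := hij
    have hne : j ≠ i := by rintro rfl; exact lt_irrefl _ hij
    unfold parentMatrix
    split_ifs with hi
    · subst hi; simp [hne]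
    · have := hd i hi
      have hne' : j ≠ p i := by rintro rfl; omega
      simp [hne, hne']
  rw [hb.det]
  refine Finset.prod_eq_one fun a _ => ?_
  suffices h1 : (parentMatrix r p).toSquareBlock (fun v => OrderDual.toDual (d v)) a = 1 by
    rw [h1, Matrix.det_one]
  ext ⟨i, hi⟩ ⟨j, hj⟩
  simp only [Matrix.toSquareBlock_def, Matrix.of_apply, Matrix.one_apply, Subtype.mk.injEq]
  have hdij : d i = d j := by
    have := hi.trans hj.symm
    exact this
  unfold parentMatrix
  split_ifs with h1 h2 h2
  · subst h1; subst h2; simp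
  · subst h1; simp [Ne.symm h2]
  · subst h2
    have := hd i h1
    have hne' : i ≠ p i := by intro h; rw [← h] at this; omega
    simp [hne']
  · have := hd i h1
    have hne' : j ≠ p i := by rintro rfl; omega
    simp [Ne.symm h2, hne']

/-- The indicator of the vertices that never reach `r` is a nonzero kernel vector: a non-root vertex
and its parent agree on reaching `r`. -/
theorem det_parentMatrix_of_not_reach (r : V) (p : V → V) (h : ¬ ∀ v, ∃ m, p^[m] v = r) :
    (parentMatrix r p).det = 0 := by
  classical
  push Not at h
  obtain ⟨v₀, hv₀⟩ := h
  rw [← Matrix.exists_mulVec_eq_zero_iff]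
  refine ⟨fun v => if ∃ m, p^[m] v = r then 0 else 1, ?_, ?_⟩
  · intro h
    have := congrFun h v₀
    simp [hv₀] at this
  · ext v
    have hr : ∃ m, p^[m] r = r := ⟨0, rfl⟩
    unfold parentMatrix Matrix.mulVec
    simp only
    split_ifs with hv
    · simp [hr]
    · rw [sub_dotProduct]
      simp only [single_one_dotProduct, Pi.zero_apply]
      have : (∃ m, p^[m] v = r) ↔ ∃ m, p^[m] (p v) = r := by
        constructor
        · rintro ⟨m, hm⟩
          rcases m with _ | m
          · exact absurd hm hv
          · exact ⟨m, hm⟩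
        · rintro ⟨m, hm⟩
          exact ⟨m + 1, hm⟩
      simp [this]

/-- `p` is the parent function of a spanning arborescence with root `r` along the relation `adj`,
extended by `p r = r`. -/
def IsParentFunction (adj : V → V → Prop) (r : V) (p : V → V) : Prop :=
  p r = r ∧ (∀ v, v ≠ r → adj (p v) v) ∧ ∀ v, ∃ m, p^[m] v = r

/-- The in-degree Laplacian of a relation: rows are indexed by heads. -/
def inLaplacian (adj : V → V → Prop) [DecidableRel adj] : Matrix V V ℚ :=
  fun v => ∑ u, (if adj u v then (1 : ℚ) else 0) • (Pi.single v 1 - Pi.single u 1)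

open Classical in
/-- Matrix-tree theorem for the arborescences of a simple digraph. -/
theorem det_inLaplacian_updateRow (adj : V → V → Prop) [DecidableRel adj] (r : V) :
    ((inLaplacian adj).updateRow r (Pi.single r 1)).det =
      ((Finset.univ.filter (IsParentFunction adj r)).card : ℚ) := by
  -- Each row is a weighted sum over possible parents `u`, so multilinearity expands the determinant
  -- over all functions `p`. At `r` only `u = r` has nonzero weight, which forces `p r = r`.
  let c : V → V → ℚ := fun v u =>
    if v = r then (if u = r then 1 else 0) else (if adj u v then 1 else 0)
  let b : V → V → V → ℚ := fun v u =>
    if v = r then Pi.single r 1 else Pi.single v 1 - Pi.single u 1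
  have hrow : (inLaplacian adj).updateRow r (Pi.single r 1) =
      fun v => ∑ u, c v u • b v u := by
    funext v
    by_cases hv : v = r
    · subst hv
      simp [c, b]
    · rw [Matrix.updateRow_ne hv]
      simp [c, b, hv, inLaplacian]
  rw [hrow]
  change (Matrix.detRowAlternating (R := ℚ) (n := V)).toMultilinearMap _ = _
  rw [MultilinearMap.map_sum, Finset.card_filter, Nat.cast_sum]
  refine Finset.sum_congr rfl fun p _ => ?_
  rw [MultilinearMap.map_smul_univ]
  have hb : (fun v => b v (p v)) = parentMatrix r p := rfl
  rw [hb]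
  change _ • (parentMatrix r p).det = _
  by_cases h : ∀ v, ∃ m, p^[m] v = r
  · rw [det_parentMatrix_of_reach r p h]
    by_cases h2 : p r = r ∧ ∀ v, v ≠ r → adj (p v) v
    · have : IsParentFunction adj r p := ⟨h2.1, h2.2, h⟩
      rw [if_pos this]
      have : ∏ v, c v (p v) = 1 := by
        refine Finset.prod_eq_one fun v _ => ?_
        by_cases hv : v = r
        · subst hv; simp [c, h2.1]
        · simp [c, hv, h2.2 v hv]
      simp [this]
    · have h3 : ¬ IsParentFunction adj r p := fun h => h2 ⟨h.1, h.2.1⟩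
      rw [if_neg h3]
      have : ∃ v, c v (p v) = 0 := by
        by_contra! hc
        refine h2 ⟨?_, fun v hv => ?_⟩
        · have := hc r
          by_contra h
          simp [c, h] at this
        · have := hc v
          by_contra h
          simp [c, h, hv] at this
      obtain ⟨v, hv⟩ := this
      rw [Finset.prod_eq_zero (Finset.mem_univ v) hv]
      simp
  · rw [det_parentMatrix_of_not_reach r p h]
    have h3 : ¬ IsParentFunction adj r p := fun h' => h h'.2.2
    simp [h3]

/-- For a matrix with zero row and column sums, adding the all-ones matrix gives `n ^ 2` times any
principal cofactor. -/
theorem det_add_one_of_sum_eq_zero (L : Matrix V V ℚ) (hrow : ∀ i, ∑ j, L i j = 0)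
    (hcol : ∀ j, ∑ i, L i j = 0) (r : V) :
    (L + Matrix.of fun _ _ => 1).det =
      (Fintype.card V : ℚ) ^ 2 * (L.updateRow r (Pi.single r 1)).det := by
  set M : Matrix V V ℚ := L + Matrix.of fun _ _ => 1 with hM
  set n : ℚ := (Fintype.card V : ℚ) with hn
  -- The rows of `M` add up to the constant row `n`, as the columns of `L` sum to zero.
  have h1 : M.det = n * (M.updateRow r fun _ => 1).det := by
    have := Matrix.det_updateRow_sum M r (fun _ => 1)
    rw [one_smul] at this
    rw [← this, ← Matrix.det_updateRow_smul]
    congr 2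
    ext j
    rw [Finset.sum_apply]
    simp [hM, Finset.sum_add_distrib, hcol, hn]
  have h2 : (M.updateRow r fun _ => 1).det = (L.updateRow r fun _ => 1).det := by
    refine Matrix.det_eq_of_forall_row_eq_smul_add_const (fun i => if i = r then 0 else 1) r
      (by simp) ?_
    intro i j
    by_cases hi : i = r
    · subst hi; simp
    · simp [hi, hM]
  have h3 : (L.updateRow r fun _ => 1).det = n * (L.updateRow r (Pi.single r 1)).det := by
    rw [← Matrix.det_updateRow_smul]
    -- The first summand has zero sum; with it as row `r`, the matrix kills the all-ones vector and
    -- contributes nothing.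
    have : (fun _ => 1 : V → ℚ) = ((fun _ => 1) - n • Pi.single r 1) + n • Pi.single r 1 := by
      simp
    rw [this, Matrix.det_updateRow_add, add_eq_right]
    rw [← Matrix.exists_mulVec_eq_zero_iff]
    refine ⟨fun _ => 1, ?_, ?_⟩
    · intro h
      exact one_ne_zero (congrFun h r)
    · ext i
      by_cases hi : i = r
      · subst hi
        simp [Matrix.mulVec, dotProduct, Finset.sum_sub_distrib, hn, Pi.single_apply]
      · simp [Matrix.mulVec, dotProduct, Matrix.updateRow_ne hi, hrow]
  rw [h1, h2, h3]
  ring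

end ParentFunctions

/-! ### Determinant of `x I + P_σ` through the cycles of `σ` -/

section PermDet

variable {V : Type*} [Fintype V] [DecidableEq V]

open Equiv

/-- The matrix `x I + P_σ` on the support of `σ`, and the identity off it. -/
def supportMatrix (x : ℚ) (σ : Perm V) : Matrix V V ℚ :=
  fun i => if σ i = i then Pi.single i 1 else x • Pi.single i 1 + Pi.single (σ i) 1

theorem supportMatrix_mul_of_disjoint (x : ℚ) {σ τ : Perm V} (h : σ.Disjoint τ) :
    supportMatrix x (σ * τ) = supportMatrix x σ * supportMatrix x τ := by
  have hfix : ∀ i, τ i = i → supportMatrix x τ i = Pi.single i 1 := fun i hi => by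
    simp [supportMatrix, hi]
  funext i
  rw [Matrix.mul_apply_eq_vecMul]
  rcases h i with hσ | hτ
  · have e : supportMatrix x σ i = Pi.single i 1 := by simp [supportMatrix, hσ]
    rw [e, Matrix.single_one_vecMul]
    have : (σ * τ) i = τ i := by
      rw [h.commute.eq, Perm.mul_apply, hσ]
    simp only [supportMatrix, this]
    rfl
  · by_cases hσ : σ i = i
    · have e : supportMatrix x σ i = Pi.single i 1 := by simp [supportMatrix, hσ]
      rw [e, Matrix.single_one_vecMul]
      change _ = supportMatrix x τ i
      rw [hfix i hτ]
      simp [supportMatrix, hτ, hσ]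
    · have hτ' : τ (σ i) = σ i := by
        rcases h (σ i) with h1 | h1
        · exact absurd (σ.injective h1) hσ
        · exact h1
      have e : supportMatrix x σ i = x • Pi.single i 1 + Pi.single (σ i) 1 := by
        simp [supportMatrix, hσ]
      rw [e, Matrix.add_vecMul, Matrix.smul_vecMul, Matrix.single_one_vecMul,
        Matrix.single_one_vecMul]
      change _ = x • supportMatrix x τ i + supportMatrix x τ (σ i)
      rw [hfix i hτ, hfix _ hτ']
      simp [supportMatrix, hτ, hσ]

/-- Only `1` and `σ` survive in the Leibniz expansion. A surviving `τ` either fixes a point or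
agrees with `σ` there; by injectivity, moving one point forces it to move the next, hence the whole
cycle. -/
theorem det_supportMatrix_of_isCycle (x : ℚ) {σ : Perm V} (h : σ.IsCycle) :
    (supportMatrix x σ).det = x ^ σ.support.card + (-1) ^ (σ.support.card + 1) := by
  have hne : σ ≠ 1 := h.ne_one
  have key : ∀ τ : Perm V, τ ≠ 1 → τ ≠ σ → ∃ i, supportMatrix x σ i (τ i) = 0 := by
    intro τ h1 h2
    by_contra! hc
    have hfix : ∀ i, σ i = i → τ i = i := by
      intro i hi
      by_contra hne
      apply hc i
      simp [supportMatrix, hi, hne]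
    have hmov : ∀ i, τ i = i ∨ τ i = σ i := by
      intro i
      by_contra! hne
      apply hc i
      unfold supportMatrix
      split_ifs with hi
      · simp [hne.1]
      · simp [hne.1, hne.2]
    obtain ⟨i, hi⟩ : ∃ i, τ i ≠ i := by
      by_contra! hall
      exact h1 (Perm.ext hall)
    have hstep : ∀ j, τ j ≠ j → τ (σ j) ≠ σ j := by
      intro j hj hj'
      have h3 := (hmov j).resolve_left hj
      exact hj (by rw [h3]; exact τ.injective (by rw [hj', h3]))
    have hpow : ∀ n : ℕ, τ ((σ ^ n) i) ≠ (σ ^ n) i := by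
      intro n
      induction n with
      | zero => simpa using hi
      | succ n ih =>
        rw [pow_succ', Perm.mul_apply]
        exact hstep _ ih
    apply h2
    ext j
    by_cases hj : σ j = j
    · rw [hfix j hj, hj]
    · have hσi : σ i ≠ i := fun h => hi (hfix i h)
      obtain ⟨n, hn⟩ := h.exists_pow_eq hσi hj
      have := hpow n
      rw [hn] at this
      exact (hmov j).resolve_left this
  rw [← Matrix.det_transpose, Matrix.det_apply, ← Finset.sum_subset (Finset.subset_univ {1, σ})]
  · rw [Finset.sum_pair hne.symm]
    congr 1
    · simp only [Perm.sign_one, one_smul, Perm.one_apply, Matrix.transpose_apply]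
      have : ∀ i, supportMatrix x σ i i = if i ∈ σ.support then x else 1 := by
        intro i
        by_cases hi : σ i = i
        · simp [supportMatrix, hi]
        · simp [supportMatrix, hi, Ne.symm hi]
      rw [Finset.prod_congr rfl fun i _ => this i, Finset.prod_ite,
        Finset.filter_univ_mem]
      simp
    · have : ∀ i, supportMatrix x σ i (σ i) = 1 := by
        intro i
        by_cases hi : σ i = i
        · simp [supportMatrix, hi]
        · simp [supportMatrix, hi]
      simp only [Matrix.transpose_apply, this, Finset.prod_const_one, h.sign]
      simp [Units.smul_def, pow_succ]
  · intro τ _ hτ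
    simp only [Finset.mem_insert, Finset.mem_singleton, not_or] at hτ
    obtain ⟨i, hi⟩ := key τ hτ.1 hτ.2
    rw [Finset.prod_eq_zero (Finset.mem_univ i) (by simpa using hi), smul_zero]

theorem det_supportMatrix (x : ℚ) (σ : Perm V) :
    (supportMatrix x σ).det = (σ.cycleType.map fun l => x ^ l + (-1) ^ (l + 1)).prod := by
  induction σ using Perm.cycle_induction_on with
  | base_one =>
    have : supportMatrix x (1 : Perm V) = 1 := by
      ext i j
      simp [supportMatrix, Matrix.one_apply, Pi.single_apply, eq_comm]
    simp [this]
  | base_cycles σ h => simp [det_supportMatrix_of_isCycle x h, h.cycleType]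
  | induction_disjoint σ τ h _ ih1 ih2 =>
    rw [supportMatrix_mul_of_disjoint x h, Matrix.det_mul, ih1, ih2, h.cycleType_mul,
      Multiset.map_add, Multiset.prod_add]

end PermDet

/-! ### Euler circuits -/

section Euler

variable {V : Type*}

/-- If the multiset of arcs `R` is balanced up to the end points `z` and `u`, then it contains a
trail from `z` to `u`. -/
theorem exists_trail (R : Multiset (V × V)) (z u : V)
    (h : R.map Prod.fst + {u} = R.map Prod.snd + {z}) :
    ∃ a : List V, (z :: a).getLast (List.cons_ne_nil _ _) = u ∧
      (↑((z :: a).zip a) : Multiset (V × V)) ≤ R := by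
  induction hn : Multiset.card R generalizing R z with
  | zero =>
    rw [Multiset.card_eq_zero] at hn
    subst hn
    refine ⟨[], ?_, by simp⟩
    have : u = z := by simpa using h
    simp [this]
  | succ n ih =>
    -- Greedy walk: stop at `u`; otherwise balance supplies an unused arc out of `z`, and its head
    -- is the new starting point.
    by_cases hzu : z = u
    · exact ⟨[], by simp [hzu], by simp⟩
    · have hz : z ∈ R.map Prod.fst := by
        have : z ∈ R.map Prod.fst + {u} := by rw [h]; simp
        rcases Multiset.mem_add.mp this with h1 | h1
        · exact h1
        · exact absurd (Multiset.mem_singleton.mp h1) hzu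
      obtain ⟨⟨z', y⟩, hmem, rfl⟩ := Multiset.mem_map.mp hz
      obtain ⟨R', rfl⟩ := Multiset.exists_cons_of_mem hmem
      obtain ⟨a, ha, hle⟩ := ih R' y (by
        rw [Multiset.map_cons, Multiset.map_cons] at h
        simp only [← Multiset.singleton_add] at h
        have h' : {z'} + (R'.map Prod.fst + {u}) = {z'} + (R'.map Prod.snd + {y}) := by
          rw [← add_assoc, h]
          abel
        exact add_left_cancel h') (by simpa using hn)
      refine ⟨y :: a, by simpa using ha, ?_⟩
      rw [List.zip_cons_cons, ← Multiset.cons_coe]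
      exact Multiset.cons_le_cons _ hle

/-- The arcs of the closed walk through the vertices of `w`. -/
def closedArcs (w : List V) : Multiset (V × V) := ↑(w.zip (w.rotate 1))

theorem closedArcs_cons (u : V) (a : List V) :
    closedArcs (u :: a) = ↑((u :: a).zip (a ++ [u])) := by
  simp [closedArcs]

theorem closedArcs_rotate (w : List V) (n : ℕ) : closedArcs (w.rotate n) = closedArcs w := by
  unfold closedArcs
  rw [List.rotate_rotate, Nat.add_comm, ← List.rotate_rotate, List.zip,
    ← List.zipWith_rotate_distrib _ _ _ _ (by simp), Multiset.coe_eq_coe]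
  exact List.rotate_perm _ _

theorem closedArcs_append (u : V) (a b : List V) :
    closedArcs (u :: a ++ u :: b) = closedArcs (u :: a) + closedArcs (u :: b) := by
  rw [List.cons_append, closedArcs_cons, closedArcs_cons, closedArcs_cons, Multiset.coe_add,
    ← List.zip_append (by simp)]
  simp

theorem map_fst_closedArcs (w : List V) : (closedArcs w).map Prod.fst = ↑w := by
  simp [closedArcs, List.map_fst_zip]

theorem map_snd_closedArcs (w : List V) : (closedArcs w).map Prod.snd = ↑w := by
  simp only [closedArcs, Multiset.map_coe, Multiset.coe_eq_coe]
  rw [List.map_snd_zip (by simp)]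
  exact List.rotate_perm _ _

/-- Removing the arc `(u, y)` leaves the rest balanced up to end points, so it contains a trail from
`y` back to `u`. The final `u` is dropped because `closedArcs` closes up cyclically. -/
theorem exists_closed_of_balanced (R : Multiset (V × V)) (h : R.map Prod.fst = R.map Prod.snd)
    {u y : V} (hu : (u, y) ∈ R) : ∃ a : List V, closedArcs (u :: a) ≤ R := by
  obtain ⟨R', rfl⟩ := Multiset.exists_cons_of_mem hu
  obtain ⟨a, ha, hle⟩ := exists_trail R' y u (by
    rw [Multiset.map_cons, Multiset.map_cons] at h
    simp only [← Multiset.singleton_add] at h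
    rw [add_comm, h, add_comm])
  refine ⟨(y :: a).dropLast, ?_⟩
  rw [closedArcs_cons]
  have e : (y :: a).dropLast ++ [u] = y :: a := by
    conv_rhs => rw [← List.dropLast_append_getLast (List.cons_ne_nil y a), ha]
  rw [e, List.zip_cons_cons, ← Multiset.cons_coe]
  refine Multiset.cons_le_cons _ (le_trans (le_of_eq ?_) hle)
  congr 1
  have hlen : (y :: a).dropLast.length = a.length := by simp
  conv_rhs => rw [← e]
  have := List.zip_append (l₁ := (y :: a).dropLast) (r₁ := [u]) (l₂ := a) (r₂ := ([] : List V)) hlen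
  simpa using this.symm

/-- A balanced digraph without proper nonempty sets of vertices closed under its arcs is
Eulerian. -/
theorem MultiDigraph.isEulerian_of_balanced [DecidableEq V] (D : MultiDigraph V)
    (hbal : D.arcs.map Prod.fst = D.arcs.map Prod.snd) (hne : D.arcs ≠ 0)
    (hconn : ∀ S : Set V, S.Nonempty → (∀ x y, (x, y) ∈ D.arcs → x ∈ S → y ∈ S) →
      ∀ v ∈ D.verts, v ∈ S) : D.IsEulerian := by
  -- Hierholzer's argument, by strong induction on the number of unused arcs.
  have main : ∀ n : ℕ, ∀ u : V, ∀ a : List V, closedArcs (u :: a) ≤ D.arcs →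
      Multiset.card (D.arcs - closedArcs (u :: a)) = n → D.IsEulerian := by
    intro n
    induction n using Nat.strong_induction_on with
    | _ n ih =>
      intro u a hle hn
      obtain ⟨R, hR⟩ := Multiset.le_iff_exists_add.mp hle
      rw [hR, add_tsub_cancel_left] at hn
      by_cases hused : ∃ x ∈ u :: a, ∃ y, (x, y) ∈ R
      · obtain ⟨x, hx, y, hxy⟩ := hused
        have hRbal : R.map Prod.fst = R.map Prod.snd := by
          rw [hR, Multiset.map_add, Multiset.map_add, map_fst_closedArcs,
            map_snd_closedArcs] at hbal
          exact add_left_cancel hbal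
        obtain ⟨c, hc⟩ := exists_closed_of_balanced R hRbal hxy
        obtain ⟨R', hR'⟩ := Multiset.le_iff_exists_add.mp hc
        obtain ⟨s, t, hst⟩ := List.append_of_mem hx
        -- Rotate the circuit to start at `x`, so that the new closed trail can be spliced in.
        have hrot : closedArcs (x :: (t ++ s)) = closedArcs (u :: a) := by
          rw [hst, ← closedArcs_rotate (s ++ x :: t) s.length, List.rotate_append_length_eq]
          simp
        have htot : D.arcs = closedArcs (x :: (c ++ x :: (t ++ s))) + R' := by
          rw [← List.cons_append, closedArcs_append, hrot, hR, hR']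
          abel
        refine ih (Multiset.card R') ?_ x (c ++ x :: (t ++ s)) ?_ ?_
        · rw [← hn, hR', Multiset.card_add, closedArcs_cons]
          simp
        · rw [htot]; exact Multiset.le_add_right _ _
        · rw [htot, add_tsub_cancel_left]
      · push Not at hused
        -- No unused arc leaves the circuit, so its vertex set is closed under arcs and contains
        -- every vertex; then no unused arc is left.
        have hS := hconn {v | v ∈ u :: a} ⟨u, by simp⟩ (by
          intro x y hxy hx
          rw [hR] at hxy
          rcases Multiset.mem_add.mp hxy with h | h
          · have : y ∈ (closedArcs (u :: a)).map Prod.snd := Multiset.mem_map.mpr ⟨_, h, rfl⟩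
            rw [map_snd_closedArcs] at this
            exact this
          · exact absurd h (hused x hx y))
        have hR0 : R = 0 := by
          refine Multiset.eq_zero_of_forall_notMem ?_
          rintro ⟨x, y⟩ hxy
          have hx : x ∈ D.verts := (D.incidence (x, y) (by rw [hR]; simp [hxy])).1
          exact hused x (hS x hx) y hxy
        exact ⟨u :: a, by rw [hR, hR0, add_zero]; rfl, hS⟩
  obtain ⟨⟨u, y⟩, hu⟩ := Multiset.exists_mem_of_ne_zero hne
  obtain ⟨a, ha⟩ := exists_closed_of_balanced D.arcs hbal hu
  exact main _ u a ha rfl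

theorem MultiDigraph.IsEulerian.exists_arc_from [DecidableEq V] {D : MultiDigraph V}
    (h : D.IsEulerian) {v : V} (hv : v ∈ D.verts) : ∃ y, (v, y) ∈ D.arcs := by
  obtain ⟨w, hw, hall⟩ := h
  have h1 : v ∈ (closedArcs w).map Prod.fst := by
    rw [map_fst_closedArcs]
    exact hall v hv
  obtain ⟨⟨x, y⟩, hxy, rfl⟩ := Multiset.mem_map.mp h1
  exact ⟨y, hw ▸ hxy⟩

end Euler

/-! ### Arborescences and parent functions -/

section Arborescences

variable {V : Type*} [Fintype V] [DecidableEq V]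

open Classical in
/-- For a digraph without parallel arcs, arborescences are counted by their parent functions. -/
theorem MultiDigraph.tau_eq_card_isParentFunction (D : MultiDigraph V) (adj : V → V → Prop)
    (hverts : D.verts = Finset.univ)
    (harcs : D.arcs = (Finset.univ.filter fun a : V × V => adj a.1 a.2).val) (r : V) :
    D.tau r = (Finset.univ.filter (IsParentFunction adj r)).card := by
  have hcount : ∀ a : (V × V) × ℕ, a ∈ D.arcs.toEnumFinset ↔ adj a.1.1 a.1.2 ∧ a.2 = 0 := by
    rintro ⟨a, n⟩
    rw [Multiset.mem_toEnumFinset, harcs, Multiset.count_eq_of_nodup (Finset.nodup _)]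
    by_cases h : adj a.1 a.2 <;> simp [h]
  symm
  unfold MultiDigraph.tau
  refine Finset.card_bij
    (fun p _ => (Finset.univ.erase r).image fun v => (((p v, v), 0) : (V × V) × ℕ)) ?_ ?_ ?_
  · intro p hp
    obtain ⟨hr, hadj, hreach⟩ := (Finset.mem_filter.mp hp).2
    set T := (Finset.univ.erase r).image fun v => (((p v, v), 0) : (V × V) × ℕ) with hT
    have hmem : ∀ a, a ∈ T ↔ a.1.2 ≠ r ∧ a = ((p a.1.2, a.1.2), 0) := by
      intro a
      simp only [hT, Finset.mem_image, Finset.mem_erase, Finset.mem_univ, and_true]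
      constructor
      · rintro ⟨v, hv, rfl⟩
        exact ⟨hv, rfl⟩
      · rintro ⟨h1, h2⟩
        exact ⟨_, h1, h2.symm⟩
    have hsub : T ⊆ D.arcs.toEnumFinset := by
      intro a ha
      obtain ⟨h1, h2⟩ := (hmem a).mp ha
      rw [hcount, h2]
      exact ⟨hadj _ h1, rfl⟩
    refine Finset.mem_filter.mpr ⟨Finset.mem_powerset.mpr hsub, hsub, by simp [hverts],
      fun a ha => ((hmem a).mp ha).1, ?_, ?_⟩
    · intro v _ hv
      refine ⟨((p v, v), 0), ⟨(hmem _).mpr ⟨hv, rfl⟩, rfl⟩, ?_⟩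
      rintro a ⟨ha, rfl⟩
      exact ((hmem a).mp ha).2
    · intro v _
      obtain ⟨m, hm⟩ := hreach v
      induction m generalizing v with
      | zero =>
        have : v = r := hm
        rw [this]
      | succ m ih =>
        by_cases hv : v = r
        · rw [hv]
        · exact (ih (p v) (by simp [hverts]) hm).tail ⟨((p v, v), 0), (hmem _).mpr ⟨hv, rfl⟩, rfl⟩
  · intro p hp q hq hpq
    obtain ⟨hpr, -, -⟩ := (Finset.mem_filter.mp hp).2
    obtain ⟨hqr, -, -⟩ := (Finset.mem_filter.mp hq).2
    funext v
    by_cases hv : v = r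
    · rw [hv, hpr, hqr]
    · have : (((p v, v), 0) : (V × V) × ℕ) ∈
          (Finset.univ.erase r).image fun v => (((q v, v), 0) : (V × V) × ℕ) := by
        rw [← hpq]
        exact Finset.mem_image.mpr ⟨v, by simp [hv], rfl⟩
      obtain ⟨w, -, hw⟩ := Finset.mem_image.mp this
      simp only [Prod.mk.injEq, and_true] at hw
      rw [← hw.1, hw.2]
  · intro T hT
    obtain ⟨hsub, -, hroot, huniq, hreach⟩ := (Finset.mem_filter.mp hT).2
    have hex : ∀ v, ∃ u, (v = r → u = r) ∧ (v ≠ r → ((u, v), 0) ∈ T ∧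
        ∀ a ∈ T, a.1.2 = v → a = ((u, v), 0)) := by
      intro v
      by_cases hv : v = r
      · exact ⟨r, fun _ => rfl, fun h => absurd hv h⟩
      · obtain ⟨⟨⟨u, w⟩, n⟩, ⟨ha, haw⟩, hall⟩ := huniq v (by simp [hverts]) hv
        have hn := ((hcount _).mp (hsub ha)).2
        simp only at haw hn
        subst haw hn
        exact ⟨u, fun h => absurd h hv, fun _ => ⟨ha, fun a h1 h2 => hall a ⟨h1, h2⟩⟩⟩
    choose p hp1 hp2 using hex
    refine ⟨p, Finset.mem_filter.mpr ⟨Finset.mem_univ _, hp1 r rfl,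
      fun v hv => ((hcount _).mp (hsub (hp2 v hv).1)).1, ?_⟩, ?_⟩
    · intro v
      have := hreach v (by simp [hverts])
      induction this with
      | refl => exact ⟨0, rfl⟩
      | @tail x y _ hxy ih =>
        obtain ⟨a, ha, hay⟩ := hxy
        have hy : y ≠ r := by
          have := hroot a ha
          rwa [hay] at this
        have h1 := (hp2 y hy).2 a ha (by rw [hay])
        have h2 : x = p y := by
          rw [h1] at hay
          simpa using hay.symm
        obtain ⟨m, hm⟩ := ih
        exact ⟨m + 1, by rw [Function.iterate_succ_apply, ← h2, hm]⟩
    · ext a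
      simp only [Finset.mem_image, Finset.mem_erase, Finset.mem_univ, and_true]
      constructor
      · rintro ⟨v, hv, rfl⟩
        exact (hp2 v hv).1
      · intro ha
        exact ⟨a.1.2, hroot a ha, ((hp2 _ (hroot a ha)).2 a ha rfl).symm⟩

end Arborescences

/-! ### Digraphs of rootings -/

section Rootings

variable {V : Type*} [DecidableEq V]

theorem rootedDigraph_arcs (R : List (RootedEdge V)) :
    (rootedDigraph R).arcs = (R.map fun s => s.star.arcs).sum := by
  induction R with
  | nil => rfl
  | cons s R ih =>
    rw [List.map_cons, List.sum_cons, ← ih]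
    rfl

theorem mem_rootedDigraph_verts (R : List (RootedEdge V)) (v : V) :
    v ∈ (rootedDigraph R).verts ↔ ∃ s ∈ R, v ∈ s.edge := by
  induction R with
  | nil => simp [rootedDigraph, MultiDigraph.empty]
  | cons s R ih =>
    have : (rootedDigraph (s :: R)).verts = s.edge ∪ (rootedDigraph R).verts := rfl
    simp [this, ih]

theorem exists_root_of_mem_arcs {R : List (RootedEdge V)} {x y : V}
    (h : (x, y) ∈ (rootedDigraph R).arcs) : ∃ s ∈ R, s.root = x := by
  induction R with
  | nil => simp [rootedDigraph, MultiDigraph.empty] at h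
  | cons s R ih =>
    have e : (rootedDigraph (s :: R)).arcs = s.star.arcs + (rootedDigraph R).arcs := rfl
    rw [e] at h
    rcases Multiset.mem_add.mp h with h | h
    · obtain ⟨v, -, hv⟩ := Multiset.mem_map.mp h
      exact ⟨s, by simp, congrArg Prod.fst hv⟩
    · obtain ⟨t, ht, hx⟩ := ih h
      exact ⟨t, by simp [ht], hx⟩

end Rootings

/-! ### Rootings of the simplex and their digraphs -/

section Simplex

variable {k : ℕ}

/-- The arcs of the digraph of the rooting attached to `σ`. -/
def derangementAdj (σ : Equiv.Perm (Fin (k + 1))) (x y : Fin (k + 1)) : Prop :=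
  y ≠ x ∧ y ≠ σ x

instance (σ : Equiv.Perm (Fin (k + 1))) : DecidableRel (derangementAdj σ) :=
  fun x y => inferInstanceAs (Decidable (y ≠ x ∧ y ≠ σ x))

theorem derangementRooting_arcs (σ : derangements (Fin (k + 1))) :
    (rootedDigraph (derangementRooting k σ)).arcs =
      (Finset.univ.filter fun a : Fin (k + 1) × Fin (k + 1) =>
        derangementAdj σ.1 a.1 a.2).val := by
  rw [rootedDigraph_arcs, derangementRooting, List.map_ofFn, List.sum_ofFn]
  ext ⟨x, y⟩
  rw [Multiset.count_sum', Multiset.count_eq_of_nodup (Finset.nodup _),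
    Finset.sum_eq_single_of_mem x (Finset.mem_univ _)]
  · have hinj : Function.Injective (fun v : Fin (k + 1) => (x, v)) := fun a b h => by
      simpa using h
    simp only [Function.comp_apply, RootedEdge.star]
    rw [Multiset.count_map_eq_count' _ _ hinj, Multiset.count_eq_of_nodup (Finset.nodup _)]
    simp only [Finset.mem_val, Finset.mem_erase, Finset.mem_filter, Finset.mem_univ, and_true,
      true_and]
    rfl
  · intro b _ hb
    rw [Multiset.count_eq_zero]
    intro h
    simp only [Function.comp_apply, RootedEdge.star] at h
    obtain ⟨v, -, hv⟩ := Multiset.mem_map.mp h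
    exact hb (congrArg Prod.fst hv)

theorem derangementRooting_verts (σ : derangements (Fin (k + 1))) :
    (rootedDigraph (derangementRooting k σ)).verts = Finset.univ := by
  ext v
  rw [mem_rootedDigraph_verts]
  simp only [Finset.mem_univ, iff_true]
  refine ⟨_, (List.mem_ofFn' _ _).mpr ⟨v, rfl⟩, ?_⟩
  simpa using (σ.2 v).symm

theorem card_fst_derangementAdj (σ : derangements (Fin (k + 1))) (v : Fin (k + 1)) :
    ((Finset.univ.filter fun a : Fin (k + 1) × Fin (k + 1) =>
      derangementAdj σ.1 a.1 a.2).filter fun a => a.1 = v).card = k - 1 := by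
  have : ((Finset.univ.filter fun a : Fin (k + 1) × Fin (k + 1) =>
      derangementAdj σ.1 a.1 a.2).filter fun a => a.1 = v) =
      ((Finset.univ.erase v).erase (σ.1 v)).image fun y => (v, y) := by
    ext ⟨x, y⟩
    simp only [Finset.mem_filter, Finset.mem_univ, true_and, Finset.mem_image, Finset.mem_erase,
      and_true, Prod.mk.injEq]
    constructor
    · rintro ⟨⟨h1, h2⟩, rfl⟩
      exact ⟨y, ⟨h2, h1⟩, rfl, rfl⟩
    · rintro ⟨_, ⟨h2, h1⟩, rfl, rfl⟩
      exact ⟨⟨h1, h2⟩, rfl⟩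
  rw [this, Finset.card_image_of_injective _ (fun a b h => by simpa using h),
    Finset.card_erase_of_mem (by simpa using σ.2 v), Finset.card_erase_of_mem (by simp)]
  simp

theorem card_snd_derangementAdj (σ : derangements (Fin (k + 1))) (v : Fin (k + 1)) :
    ((Finset.univ.filter fun a : Fin (k + 1) × Fin (k + 1) =>
      derangementAdj σ.1 a.1 a.2).filter fun a => a.2 = v).card = k - 1 := by
  have : ((Finset.univ.filter fun a : Fin (k + 1) × Fin (k + 1) =>
      derangementAdj σ.1 a.1 a.2).filter fun a => a.2 = v) =
      ((Finset.univ.erase v).erase (σ.1.symm v)).image fun y => (y, v) := by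
    ext ⟨x, y⟩
    simp only [Finset.mem_filter, Finset.mem_univ, true_and, Finset.mem_image, Finset.mem_erase,
      and_true, Prod.mk.injEq, ne_eq, Equiv.eq_symm_apply]
    constructor
    · rintro ⟨⟨h1, h2⟩, rfl⟩
      exact ⟨x, ⟨fun h => h2 h.symm, fun h => h1 h.symm⟩, rfl, rfl⟩
    · rintro ⟨_, ⟨h2, h1⟩, rfl, rfl⟩
      exact ⟨⟨fun h => h1 h.symm, fun h => h2 h.symm⟩, rfl⟩
  have hne : σ.1.symm v ≠ v := by
    intro h
    exact σ.2 v (by rw [Equiv.symm_apply_eq] at h; exact h.symm)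
  rw [this, Finset.card_image_of_injective _ (fun a b h => by simpa using h),
    Finset.card_erase_of_mem (by simpa using hne), Finset.card_erase_of_mem (by simp)]
  simp

theorem derangementRooting_inDegree (σ : derangements (Fin (k + 1))) (v : Fin (k + 1)) :
    (rootedDigraph (derangementRooting k σ)).inDegree v = k - 1 := by
  rw [← card_snd_derangementAdj σ v, MultiDigraph.inDegree, derangementRooting_arcs,
    Multiset.countP_eq_card_filter]
  rfl

theorem derangementRooting_isEulerian (hk : 2 ≤ k) (σ : derangements (Fin (k + 1))) :
    (rootedDigraph (derangementRooting k σ)).IsEulerian := by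
  apply MultiDigraph.isEulerian_of_balanced
  · rw [derangementRooting_arcs]
    ext v
    rw [Multiset.count_map, Multiset.count_map]
    have h1 := card_fst_derangementAdj σ v
    have h2 := card_snd_derangementAdj σ v
    simp only [eq_comm (a := v)]
    exact h1.trans h2.symm
  · intro h
    have h1 := derangementRooting_inDegree σ 0
    rw [MultiDigraph.inDegree, h] at h1
    simp at h1
    omega
  · rintro S ⟨s, hs⟩ hclosed v -
    rw [derangementRooting_arcs] at hclosed
    by_contra hv
    -- Path `s → y → v`: `y` must avoid only `σ s` and `σ⁻¹ v`, which is possible since `k + 1 ≥ 3`.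
    -- The cases `y = s` and `v = y` shorten the path.
    obtain ⟨y, -, hy⟩ : ∃ y ∈ (Finset.univ : Finset (Fin (k + 1))),
        y ∉ ({σ.1 s, σ.1.symm v} : Finset (Fin (k + 1))) := by
      apply Finset.exists_mem_notMem_of_card_lt_card
      have := Finset.card_le_two (a := σ.1 s) (b := σ.1.symm v)
      simp only [Finset.card_univ, Fintype.card_fin]
      omega
    simp only [Finset.mem_insert, Finset.mem_singleton, not_or, Equiv.eq_symm_apply] at hy
    have hyS : y ∈ S := by
      by_cases hys : y = s
      · rwa [hys]
      · exact hclosed s y (Finset.mem_filter.mpr ⟨Finset.mem_univ _, hys, hy.1⟩) hs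
    apply hv
    by_cases hvy : v = y
    · rwa [hvy]
    · exact hclosed y v (Finset.mem_filter.mpr ⟨Finset.mem_univ _, hvy, Ne.symm hy.2⟩) hyS

theorem exists_eq_univ_erase {e : Finset (Fin (k + 1))} (he : e.card = k) :
    ∃ a, e = Finset.univ.erase a := by
  have : eᶜ.card = 1 := by
    rw [Finset.card_compl, he]
    simp
  obtain ⟨a, ha⟩ := Finset.card_eq_one.mp this
  refine ⟨a, ?_⟩
  rw [← compl_compl e, ha]
  ext
  simp

theorem univ_erase_injective :
    Function.Injective fun a : Fin (k + 1) => (Finset.univ : Finset (Fin (k + 1))).erase a := by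
  intro a b h
  by_contra hne
  have : a ∈ (Finset.univ : Finset (Fin (k + 1))).erase b := by simp [hne]
  rw [← show Finset.univ.erase a = Finset.univ.erase b from h] at this
  simp at this

theorem derangementRooting_isRooting (σ : derangements (Fin (k + 1))) :
    (simplex k).IsRooting (derangementRooting k σ) := by
  constructor
  · rw [derangementRooting, List.map_ofFn]
    refine (Multiset.Nodup.ext ?_ (Finset.nodup _)).mpr ?_
    · rw [Multiset.coe_nodup, List.nodup_ofFn]
      exact univ_erase_injective.comp σ.1.injective
    · intro e
      rw [Multiset.mem_coe, List.mem_ofFn']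
      change _ ↔ e ∈ Finset.powersetCard k Finset.univ
      rw [Finset.mem_powersetCard]
      constructor
      · rintro ⟨i, rfl⟩
        simp
      · rintro ⟨-, he⟩
        obtain ⟨a, rfl⟩ := exists_eq_univ_erase he
        exact ⟨σ.1.symm a, by simp⟩
  · rw [derangementRooting, List.map_ofFn, List.pairwise_ofFn]
    intro i j h
    exact h.le

theorem derangementRooting_injective : Function.Injective (derangementRooting k) := by
  intro σ τ h
  have h1 := List.ofFn_injective h
  apply Subtype.ext
  ext1 i
  exact univ_erase_injective (congrArg RootedEdge.edge (congrFun h1 i))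

theorem exists_derangementRooting_eq (hk : 1 ≤ k) {R : List (RootedEdge (Fin (k + 1)))}
    (hR : R ∈ (simplex k).eulerRootings) : ∃ σ, derangementRooting k σ = R := by
  obtain ⟨⟨hedges, hsorted⟩, heuler⟩ := hR
  have hedges : (↑(R.map RootedEdge.edge) : Multiset (Finset (Fin (k + 1)))) =
    (Finset.powersetCard k Finset.univ).val := hedges
  have hlen : R.length = k + 1 := by
    have := congrArg Multiset.card hedges
    simpa using this
  have hverts : ∀ v, v ∈ (rootedDigraph R).verts := by
    intro v
    rw [mem_rootedDigraph_verts]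
    have : Nontrivial (Fin (k + 1)) := Fin.nontrivial_iff_two_le.mpr (by omega)
    obtain ⟨w, hw⟩ := exists_ne v
    have hmem : (Finset.univ.erase w : Finset (Fin (k + 1))) ∈
        (↑(R.map RootedEdge.edge) : Multiset (Finset (Fin (k + 1)))) := by
      rw [hedges, Finset.mem_val, Finset.mem_powersetCard]
      simp
    obtain ⟨s, hs, hsw⟩ := List.mem_map.mp (Multiset.mem_coe.mp hmem)
    exact ⟨s, hs, by simp [hsw, Ne.symm hw]⟩
  have hroots : ∀ v, v ∈ R.map RootedEdge.root := by
    intro v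
    obtain ⟨y, hy⟩ := heuler.exists_arc_from (hverts v)
    obtain ⟨s, hs, hsv⟩ := exists_root_of_mem_arcs hy
    exact List.mem_map.mpr ⟨s, hs, hsv⟩
  have hperm : (R.map RootedEdge.root).Perm (List.finRange (k + 1)) := by
    refine (List.subperm_of_subset (List.nodup_finRange _) fun v _ => hroots v).perm_of_length_le
      (by simp [hlen]) |>.symm
  -- Sortedness of the roots fixes the order, so the `i`-th star is rooted at `i`.
  have hrootList : R.map RootedEdge.root = List.finRange (k + 1) :=
    hperm.eq_of_pairwise (fun a b _ _ => le_antisymm) hsorted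
      ((List.pairwise_lt_finRange _).imp le_of_lt)
  have hroot : ∀ i : Fin (k + 1), (R.get (i.cast hlen.symm)).root = i := by
    intro i
    have := congrArg (fun l => l[i.1]?) hrootList
    simpa [hlen, i.2] using this
  have hcard : ∀ i : Fin (k + 1), (R.get (i.cast hlen.symm)).edge.card = k := by
    intro i
    have : (R.get (i.cast hlen.symm)).edge ∈
        (↑(R.map RootedEdge.edge) : Multiset (Finset (Fin (k + 1)))) :=
      Multiset.mem_coe.mpr (List.mem_map.mpr ⟨_, List.get_mem _ _, rfl⟩)
    rw [hedges, Finset.mem_val, Finset.mem_powersetCard] at this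
    exact this.2
  choose f hf using fun i => exists_eq_univ_erase (hcard i)
  have hnodup : (R.map RootedEdge.edge).Nodup := by
    rw [← Multiset.coe_nodup, hedges]
    exact Finset.nodup _
  have hinj : Function.Injective f := by
    intro i j hij
    have h1 : (R.get (i.cast hlen.symm)).edge = (R.get (j.cast hlen.symm)).edge := by
      rw [hf, hf, hij]
    have h2 := (List.Nodup.getElem_inj_iff hnodup (i := i.1) (j := j.1)
      (hi := by rw [List.length_map, hlen]; exact i.2)
      (hj := by rw [List.length_map, hlen]; exact j.2)).mp (by simpa using h1)
    exact Fin.ext h2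
  refine ⟨⟨Equiv.ofBijective f (Finite.injective_iff_bijective.mp hinj), ?_⟩, ?_⟩
  · intro i hi
    have hi : f i = i := hi
    have := (R.get (i.cast hlen.symm)).root_mem
    rw [hroot, hf, hi] at this
    simp at this
  · refine List.ext_get (by simp [derangementRooting, hlen]) ?_
    intro n h1 h2
    have hn : n < k + 1 := by omega
    apply RootedEdge.ext
    · have := hf ⟨n, hn⟩
      simpa [derangementRooting, -List.ofFn_succ] using this.symm
    · have := hroot ⟨n, hn⟩
      simpa [derangementRooting, -List.ofFn_succ] using this.symm

theorem bijOn_derangementRooting (hk : 2 ≤ k) :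
    Set.BijOn (derangementRooting k) Set.univ (simplex k).eulerRootings :=
  ⟨fun σ _ => ⟨derangementRooting_isRooting σ, derangementRooting_isEulerian hk σ⟩,
    derangementRooting_injective.injOn, fun _ hR => by
      obtain ⟨σ, hσ⟩ := exists_derangementRooting_eq (by omega) hR
      exact ⟨σ, trivial, hσ⟩⟩

/-- Here `L = (k - 1) I - (J - I - P)ᵀ`. As `σ` moves every point, `supportMatrix` is `k I + P`
throughout. -/
theorem inLaplacian_derangementAdj (hk : 2 ≤ k) (σ : derangements (Fin (k + 1))) :
    inLaplacian (derangementAdj σ.1) + Matrix.of (fun _ _ => 1) =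
      (supportMatrix (k : ℚ) σ.1).transpose := by
  ext v u
  have hdeg : ∑ w, (if derangementAdj σ.1 w v then (1 : ℚ) else 0) = (k : ℚ) - 1 := by
    have h := card_snd_derangementAdj σ v
    have h2 : (Finset.univ.filter fun w => derangementAdj σ.1 w v).card = k - 1 := by
      rw [← h]
      refine Finset.card_bij (fun w _ => (w, v)) ?_ ?_ ?_
      · intro w hw
        simpa using hw
      · intro a _ b _ h
        simpa using h
      · rintro ⟨x, y⟩ hxy
        simp only [Finset.mem_filter, Finset.mem_univ, true_and] at hxy
        obtain ⟨h1, rfl⟩ := hxy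
        exact ⟨x, by simpa using h1, rfl⟩
    rw [Finset.sum_boole, h2, Nat.cast_sub (by omega)]
    simp
  have hL : inLaplacian (derangementAdj σ.1) v u =
      ((k : ℚ) - 1) * (if u = v then 1 else 0) - (if derangementAdj σ.1 u v then 1 else 0) := by
    rw [← hdeg, inLaplacian, Finset.sum_apply, Finset.sum_mul]
    simp only [Pi.smul_apply, Pi.sub_apply, Pi.single_apply, smul_eq_mul, mul_sub,
      Finset.sum_sub_distrib]
    simp
  have hσ := σ.2 u
  rw [Matrix.add_apply, hL, Matrix.transpose_apply, supportMatrix, if_neg hσ]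
  simp only [Matrix.of_apply, Pi.add_apply, Pi.smul_apply, Pi.single_apply, smul_eq_mul,
    derangementAdj]
  by_cases h1 : v = u
  · subst h1
    simp [Ne.symm hσ]
  · by_cases h2 : v = σ.1 u
    · simp [h2, hσ, Ne.symm hσ]
    · simp [h1, h2, Ne.symm h1]

theorem tau_derangementRooting (hk : 2 ≤ k) (σ : derangements (Fin (k + 1))) (r : Fin (k + 1)) :
    ((k : ℚ) + 1) ^ 2 * ((rootedDigraph (derangementRooting k σ)).tau r : ℚ) =
      (σ.1.cycleType.map fun l => (k : ℚ) ^ l + (-1) ^ (l + 1)).prod := by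
  rw [← det_supportMatrix, ← Matrix.det_transpose, ← inLaplacian_derangementAdj hk σ,
    det_add_one_of_sum_eq_zero _ _ _ r, det_inLaplacian_updateRow,
    MultiDigraph.tau_eq_card_isParentFunction _ (derangementAdj σ.1)
      (derangementRooting_verts σ) (by convert derangementRooting_arcs σ)]
  · simp
  · intro v
    simp only [inLaplacian, Finset.sum_apply, Pi.smul_apply, Pi.sub_apply]
    rw [Finset.sum_comm]
    refine Finset.sum_eq_zero fun w _ => ?_
    rw [← Finset.smul_sum, Finset.sum_sub_distrib]
    simp
  · intro u
    -- Column sums of `L` are read off from `k I + Pᵀ - J`: `k + 1 - (k + 1) = 0`.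
    have h : ∀ v, inLaplacian (derangementAdj σ.1) v u = supportMatrix (k : ℚ) σ.1 u v - 1 := by
      intro v
      have := congrFun (congrFun (inLaplacian_derangementAdj hk σ) v) u
      rw [Matrix.add_apply, Matrix.transpose_apply, Matrix.of_apply] at this
      rw [← this]
      ring
    simp only [h, supportMatrix, if_neg (σ.2 u), Finset.sum_sub_distrib, Pi.add_apply,
      Finset.sum_add_distrib, Pi.smul_apply, ← Finset.smul_sum]
    simp

end Simplex

theorem theorem6p3 (k : ℕ) (hk : 2 ≤ k) :
    Set.BijOn (derangementRooting k) Set.univ (simplex k).eulerRootings ∧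
    ∀ r : Fin (k + 1),
      (simplex k).assocCoeff r =
        1 / (((k : ℚ) - 1) ^ (k + 1) * ((k : ℚ) + 1) ^ 2) *
          ∑ σ : derangements (Fin (k + 1)),
            (σ.1.cycleType.map fun l => (k : ℚ) ^ l + (-1) ^ (l + 1)).prod := by
  refine ⟨bijOn_derangementRooting hk, fun r => ?_⟩
  rw [MultiHypergraph.assocCoeff,
    ← finsum_mem_eq_of_bijOn (derangementRooting k) (bijOn_derangementRooting hk)
      (fun _ _ => rfl), finsum_mem_univ, finsum_eq_sum_of_fintype, Finset.mul_sum]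
  refine Finset.sum_congr rfl fun σ _ => ?_
  rw [← tau_derangementRooting hk σ r, derangementRooting_verts,
    Finset.prod_congr rfl fun v _ => congrArg Nat.cast (derangementRooting_inDegree σ v),
    Finset.prod_const, Finset.card_univ, Fintype.card_fin, Nat.cast_sub (by omega), Nat.cast_one]
  have h1 : (k : ℚ) + 1 ≠ 0 := by positivity
  field_simp
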